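/- Let $G$ be a finite solvable group, and let $H$ be a maximal subgroup of $G$ that is not normal in $G$. Let $\mathrm{Core}_G H=\bigcap_{g\in G} H^g$ be the largest normal subgroup of $G$ contained in $H$, let $F(X)$ denote the Fitting subgroup of a group $X$ (its largest nilpotent normal subgroup), and let $\pi(X)$ denote the set of prime divisors of $|X|$. Let $\omega$ be a non-empty subset of $\pi(F(H/\mathrm{Core}_G H))$. Then $G$ has a Hall $\omega$-subgroup $G_\omega$ (a subgroup such that every prime divisor of $|G_\omega|$ lies in $\omega$ and no prime divisor of $|G:G_\omega|$ lies in $\omega$) with $N_G(G_\omega)\subseteq H$. -/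

import Mathlib

namespace HallNormalizer

/-- `π(G)`: the set of all prime divisors of the order of the finite group `G`. -/
def primeDivisors (G : Type*) : Set ℕ :=
  {p : ℕ | p.Prime ∧ p ∣ Nat.card G}

/-- The Fitting subgroup `F(G)`: the subgroup generated by all nilpotent normal subgroups of `G`.
In a finite group it is the largest nilpotent normal subgroup. -/
def fitting (G : Type*) [Group G] : Subgroup G :=
  sSup {N : Subgroup G | N.Normal ∧ Group.IsNilpotent N}

/-- `K` is a Hall `ω`-subgroup of the finite group `G`: the order of `K` is an `ω`-number, and the
index of `K` in `G` is an `ω'`-number, that is, no prime in `ω` divides it. -/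
structure IsHallSubgroup {G : Type*} [Group G] (ω : Set ℕ) (K : Subgroup G) : Prop where
  mem_of_dvd_card : ∀ p : ℕ, p.Prime → p ∣ Nat.card K → p ∈ ω
  notMem_of_dvd_index : ∀ p : ℕ, p.Prime → p ∣ K.index → p ∉ ω

end HallNormalizer

open Subgroup

namespace HallNormalizer

/-! Modulo the core, `H` becomes a core-free maximal subgroup `M`, and a normal abelian `p`-subgroup
`N ≠ ⊥` is a complement to `M`, so the index of `H` is a power of `p`. For `q ∈ ω` let `Q ≠ ⊥` be a
normal `q`-subgroup of `M`. Then `Q` has no nontrivial fixed points on `N`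
(`inf_centralizer_eq_bot`), whereas a `p`-group would have some; so `p ∉ ω`, and a Hall `ω`-subgroup
of `H` is Hall in `G`. Its image contains `Q`, hence also centralizes nothing in `N`, which forces
its normalizer into `M` (`normalizer_le_of_inf_eq_bot`). -/

/-- A nontrivial finite solvable group has a nontrivial normal abelian `p`-subgroup. -/
theorem exists_normal_isMulCommutative_isPGroup (G : Type*) [Group G] [Finite G]
    [Group.IsSolvable G] [Nontrivial G] :
    ∃ (p : ℕ) (N : Subgroup G), p.Prime ∧ N.Normal ∧ N ≠ ⊥ ∧ IsMulCommutative N ∧ IsPGroup p N := by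
  obtain ⟨A, ⟨hA, hA0⟩, hmin⟩ := WellFounded.has_min (wellFounded_lt (α := Subgroup G))
    {A : Subgroup G | A.Normal ∧ A ≠ ⊥} ⟨⊤, inferInstance, top_ne_bot⟩
  have hcomm : ⁅A, A⁆ = ⊥ := by
    by_contra h
    exact hmin ⁅A, A⁆ ⟨inferInstance, h⟩ (Group.IsSolvable.commutator_lt_of_ne_bot hA0)
  have hA1 : ∀ a ∈ A, ∀ b ∈ A, a * b = b * a := fun a ha b hb =>
    commutatorElement_eq_one_iff_mul_comm.mp (by
      rw [← mem_bot, ← hcomm]; exact commutator_mem_commutator ha hb)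
  have : IsMulCommutative A := ⟨⟨fun a b => Subtype.ext (hA1 a a.2 b b.2)⟩⟩
  obtain ⟨p, hp, hpd⟩ := Nat.exists_prime_and_dvd (n := Nat.card A) (by rwa [Ne, card_eq_one])
  have : Fact p.Prime := ⟨hp⟩
  let P : Sylow p A := default
  have hPn : (P : Subgroup A).Normal :=
    ⟨fun x hx g => by rwa [mul_comm' g x, mul_inv_cancel_right]⟩
  have := P.characteristic_of_normal hPn
  refine ⟨p, (P : Subgroup A).map A.subtype, hp, inferInstance, ?_, ?_, P.isPGroup'.map _⟩
  · rw [Ne, map_eq_bot_iff_of_injective _ A.subtype_injective]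
    exact P.ne_bot_of_dvd_card hpd
  · refine ⟨⟨?_⟩⟩
    rintro ⟨_, a, -, rfl⟩ ⟨_, b, -, rfl⟩
    exact Subtype.ext (hA1 a a.2 b b.2)

theorem _root_.IsPGroup.eq_of_prime_dvd_card {G : Type*} [Group G] [Finite G] {p q : ℕ}
    (hp : p.Prime) (hq : q.Prime) (h : IsPGroup p G) (hd : q ∣ Nat.card G) : q = p := by
  have : Fact p.Prime := ⟨hp⟩
  obtain ⟨n, hn⟩ := IsPGroup.iff_card.mp h
  rw [hn] at hd
  exact (Nat.prime_dvd_prime_iff_eq hq hp).mp (hq.dvd_of_dvd_pow hd)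

/-- **Hall's theorem**, existence part. -/
theorem exists_isHallSubgroup (ω : Set ℕ) (G : Type*) [Group G] [Finite G]
    [Group.IsSolvable G] : ∃ K : Subgroup G, IsHallSubgroup ω K := by
  induction hn : Nat.card G using Nat.strong_induction_on generalizing G with
  | _ n ih =>
  rcases subsingleton_or_nontrivial G with hG | hG
  · refine ⟨⊥, ⟨fun p hp h => ?_, fun p hp h => ?_⟩⟩
    · rw [card_bot] at h
      exact absurd h hp.not_dvd_one
    · rw [index_bot, Nat.card_of_subsingleton (1 : G)] at h
      exact absurd h hp.not_dvd_one
  obtain ⟨p, N, hp, hN, hN0, -, hNp⟩ := exists_normal_isMulCommutative_isPGroup G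
  have hcN : 1 < Nat.card N := one_lt_card_iff_ne_bot N |>.mpr hN0
  have hlt : Nat.card (G ⧸ N) < n := by
    rw [← hn, card_eq_card_quotient_mul_card_subgroup N]
    exact lt_mul_of_one_lt_right Nat.card_pos hcN
  obtain ⟨L, hL1, hL2⟩ := ih _ hlt (G ⧸ N) rfl
  let K := L.comap (QuotientGroup.mk' N)
  have hNK : N ≤ K := by
    simpa using MonoidHom.ker_le_comap (QuotientGroup.mk' N) L
  have hKi : K.index = L.index := index_comap_of_surjective L (QuotientGroup.mk'_surjective N)
  have hKm : K.map (QuotientGroup.mk' N) = L :=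
    map_comap_eq_self_of_surjective (QuotientGroup.mk'_surjective N) L
  have hrel : (N.subgroupOf K).index = Nat.card L := by
    have := relIndex_ker (K := K) (QuotientGroup.mk' N)
    rwa [QuotientGroup.ker_mk', hKm] at this
  have hNc : Nat.card (N.subgroupOf K) = Nat.card N :=
    Nat.card_congr (subgroupOfEquivOfLe hNK).toEquiv
  by_cases hpω : p ∈ ω
  · refine ⟨K, ⟨fun q hq hd => ?_, fun q hq hd => hL2 q hq (hKi ▸ hd)⟩⟩
    rw [← card_mul_index (N.subgroupOf K), hrel, hNc] at hd
    rcases hq.dvd_mul.mp hd with h | h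
    · rwa [hNp.eq_of_prime_dvd_card hp hq h]
    · exact hL1 q hq h
  · have hcop : Nat.Coprime (Nat.card (N.subgroupOf K)) (N.subgroupOf K).index := by
      rw [hrel, hNc]
      refine Nat.coprime_of_dvd fun q hq h1 h2 => hpω ?_
      rw [← hNp.eq_of_prime_dvd_card hp hq h1]
      exact hL1 q hq h2
    -- Schur–Zassenhaus: for `p ∉ ω` the preimage `K` is too big by exactly `N`.
    obtain ⟨S, hS⟩ := exists_right_complement'_of_coprime hcop
    refine ⟨S.map K.subtype, ⟨fun q hq hd => ?_, fun q hq hd => ?_⟩⟩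
    · rw [card_map_of_injective K.subtype_injective, ← hS.symm.index_eq_card, hrel] at hd
      exact hL1 q hq hd
    · rw [index_map_subtype, hS.index_eq_card, hNc, hKi] at hd
      rcases hq.dvd_mul.mp hd with h | h
      · rwa [hNp.eq_of_prime_dvd_card hp hq h]
      · exact hL2 q hq h

/-- If `q` divides the order of the Fitting subgroup, there is a nontrivial normal `q`-subgroup. -/
theorem exists_normal_isPGroup_of_mem_primeDivisors_fitting {G : Type*} [Group G] [Finite G]
    {q : ℕ} (hq : q ∈ primeDivisors (fitting G)) :
    ∃ Q : Subgroup G, Q.Normal ∧ Q ≠ ⊥ ∧ IsPGroup q Q := by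
  obtain ⟨hqp, hqd⟩ := hq
  have : Fact q.Prime := ⟨hqp⟩
  by_contra! hno
  have hnil : ∀ N : Subgroup G, N.Normal → Group.IsNilpotent N → ¬ q ∣ Nat.card N := by
    intro N hN hNn hd
    let P : Sylow q N := default
    have hPn : (P : Subgroup N).Normal :=
      ((Group.isNilpotent_of_finite_tfae (G := N)).out 0 3 :
        Group.IsNilpotent N ↔ ∀ (p : ℕ) (_ : Fact p.Prime) (P : Sylow p N),
          (P : Subgroup N).Normal).mp hNn q ‹_› P
    have := P.characteristic_of_normal hPn
    refine hno ((P : Subgroup N).map N.subtype) inferInstance ?_ (P.isPGroup'.map _)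
    rw [Ne, map_eq_bot_iff_of_injective _ N.subtype_injective]
    exact P.ne_bot_of_dvd_card hd
  have hclosed : SupClosed {N : Subgroup G | N.Normal ∧ ¬ q ∣ Nat.card N} := by
    rintro A ⟨hA, hAq⟩ B ⟨hB, hBq⟩
    refine ⟨sup_normal A B, fun hd => ?_⟩
    rw [← relIndex_bot_left, ← relIndex_mul_relIndex ⊥ B (A ⊔ B) bot_le le_sup_right,
      relIndex_bot_left, relIndex_sup_right] at hd
    exact (hqp.dvd_mul.mp hd).elim hBq fun h => hAq (h.trans (relIndex_dvd_card B A))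
  refine (hclosed.sSup_mem (Set.toFinite _) ?_ fun N hN => ?_ : _).2 hqd
  · exact ⟨inferInstance, by simpa using hqp.ne_one⟩
  · exact ⟨hN.1, hnil N hN.1 hN.2⟩

/-- `Q` fixes some coset `gS`, so `g⁻¹Qg ≤ S`; normality removes the conjugation. -/
theorem _root_.IsPGroup.le_of_normal_of_not_dvd_index {G : Type*} [Group G] {q : ℕ}
    [Fact q.Prime] {Q S : Subgroup G} [Q.Normal] (hQ : IsPGroup q Q) (hS : ¬ q ∣ S.index) :
    Q ≤ S := by
  obtain ⟨x, hx⟩ := hQ.nonempty_fixed_point_of_prime_not_dvd_card (G ⧸ S) hS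
  induction x using QuotientGroup.induction_on with
  | H g =>
  intro y hy
  have h := hx ⟨g * y * g⁻¹, ‹Q.Normal›.conj_mem y hy g⟩
  have h' : ((g * y * g⁻¹ * g : G) : G ⧸ S) = (g : G ⧸ S) := h
  rw [eq_comm, QuotientGroup.eq] at h'
  simpa [mul_assoc] using h'

section CoreFree

variable {G : Type*} [Group G] {M N Q S : Subgroup G}

theorem sup_eq_top_of_normalCore_eq_bot (hM : IsCoatom M) (hcore : M.normalCore = ⊥)
    [hN : N.Normal] (hN0 : N ≠ ⊥) : N ⊔ M = ⊤ := by
  refine hM.2 _ (right_lt_sup.mpr fun h => hN0 ?_)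
  rw [← le_bot_iff, ← hcore]
  exact normal_le_normalCore.mpr h

theorem inf_eq_bot_of_normalCore_eq_bot (hM : IsCoatom M) (hcore : M.normalCore = ⊥)
    [hN : N.Normal] (hN0 : N ≠ ⊥) [IsMulCommutative N] : N ⊓ M = ⊥ := by
  have : (N ⊓ M).Normal := by
    rw [← normalizer_eq_top_iff, ← top_le_iff, ← sup_eq_top_of_normalCore_eq_bot hM hcore hN0]
    refine sup_le ?_ ?_
    · rw [le_normalizer_iff]
      rintro h hh k ⟨hkN, hkM⟩
      have : h * k = k * h := congrArg Subtype.val (mul_comm' (⟨h, hh⟩ : N) ⟨k, hkN⟩)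
      rw [this, mul_inv_cancel_right]
      exact ⟨hkN, hkM⟩
    · rw [le_normalizer_iff]
      exact fun h hh k hk => ⟨hN.conj_mem _ hk.1 _, M.mul_mem (M.mul_mem hh hk.2) (M.inv_mem hh)⟩
  rw [← le_bot_iff, ← hcore]
  exact normal_le_normalCore.mpr inf_le_right

/-- The intersection is normalized by `N` (abelian) and by `M`, hence normal. Were it nontrivial, it
would generate the whole group with `M`; both normalize `Q`, so `Q` would lie in the core. -/
theorem inf_centralizer_eq_bot (hM : IsCoatom M) (hcore : M.normalCore = ⊥)
    [hN : N.Normal] (hN0 : N ≠ ⊥) [IsMulCommutative N] (hQM : Q ≤ M) (hQ0 : Q ≠ ⊥)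
    (hMQ : M ≤ normalizer (Q : Set G)) : N ⊓ centralizer (Q : Set G) = ⊥ := by
  by_contra hC
  have : (N ⊓ centralizer (Q : Set G)).Normal := by
    rw [← normalizer_eq_top_iff, ← top_le_iff, ← sup_eq_top_of_normalCore_eq_bot hM hcore hN0]
    refine sup_le ?_ ?_
    · rw [le_normalizer_iff]
      rintro h hh k ⟨hkN, hkM⟩
      have : h * k = k * h := congrArg Subtype.val (mul_comm' (⟨h, hh⟩ : N) ⟨k, hkN⟩)
      rw [this, mul_inv_cancel_right]
      exact ⟨hkN, hkM⟩
    · rw [le_normalizer_iff]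
      refine fun h hh k hk => ⟨hN.conj_mem _ hk.1 _, mem_centralizer_iff.mpr fun y hy => ?_⟩
      have h1 : h⁻¹ * y * h ∈ Q := by
        simpa using (mem_normalizer_iff.mp (hMQ (M.inv_mem hh)) y).mp hy
      have h2 := mem_centralizer_iff.mp hk.2 _ h1
      calc y * (h * k * h⁻¹) = h * (h⁻¹ * y * h * k) * h⁻¹ := by group
        _ = h * (k * (h⁻¹ * y * h)) * h⁻¹ := by rw [h2]
        _ = h * k * h⁻¹ * y := by group
  have : Q.Normal := by
    rw [← normalizer_eq_top_iff, ← top_le_iff, ← sup_eq_top_of_normalCore_eq_bot hM hcore hC]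
    exact sup_le (inf_le_right.trans (centralizer_le_normalizer _)) hMQ
  refine hQ0 ?_
  rw [← le_bot_iff, ← hcore]
  exact normal_le_normalCore.mpr hQM

theorem inf_centralizer_ne_bot_of_isPGroup [Finite G] {p : ℕ} [Fact p.Prime] [hN : N.Normal]
    (hN0 : N ≠ ⊥) (hNp : IsPGroup p N) (hQp : IsPGroup p Q) :
    N ⊓ centralizer (Q : Set G) ≠ ⊥ := by
  let _ : MulAction Q N := MulAction.compHom N ((MulAut.conjNormal (H := N)).comp Q.subtype)
  have hsmul (y : Q) (n : N) : ((y • n : N) : G) = y * n * (y : G)⁻¹ := rfl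
  have hd : p ∣ Nat.card N :=
    hNp.card_eq_or_dvd.resolve_left (by rwa [card_eq_one])
  obtain ⟨b, hb, hb1⟩ := hQp.exists_fixed_point_of_prime_dvd_card_of_fixed_point N hd
    (a := 1) (fun y => Subtype.ext (by simp [hsmul]))
  intro h
  have : (b : G) ∈ N ⊓ centralizer (Q : Set G) := by
    refine ⟨b.2, mem_centralizer_iff.mpr fun y hy => ?_⟩
    have := congrArg Subtype.val (hb ⟨y, hy⟩)
    rw [hsmul] at this
    exact mul_inv_eq_iff_eq_mul.mp this
  rw [h, mem_bot] at this
  exact hb1 (Subtype.ext this.symm)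

/-- If `nm` normalizes `S`, then `n⁻¹sn ∈ M` for `s ∈ S`, so the commutator `n⁻¹sns⁻¹` lies in `N ⊓
M = ⊥` and `n` centralizes `S`. -/
theorem normalizer_le_of_inf_eq_bot (hsup : N ⊔ M = ⊤) (hinf : N ⊓ M = ⊥) [hN : N.Normal]
    (hSM : S ≤ M) (hC : N ⊓ centralizer (S : Set G) = ⊥) : normalizer (S : Set G) ≤ M := by
  intro x hx
  have hxt : x ∈ ((N ⊔ M : Subgroup G) : Set G) := by rw [hsup]; trivial
  rw [normal_mul] at hxt
  obtain ⟨n, hn, m, hm, rfl⟩ := hxt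
  suffices hn1 : n ∈ N ⊓ centralizer (S : Set G) by
    rw [hC, mem_bot] at hn1
    simpa [hn1] using hm
  refine ⟨hn, mem_centralizer_iff.mpr fun s hs => ?_⟩
  have h1 : (n * m)⁻¹ * s * (n * m) ∈ S := by
    simpa using (mem_normalizer_iff.mp (inv_mem hx) s).mp hs
  have h2 : n⁻¹ * s * n ∈ M := by
    have := M.mul_mem (M.mul_mem hm (hSM h1)) (M.inv_mem hm)
    convert this using 1
    group
  have h3 : n⁻¹ * s * n * s⁻¹ ∈ N ⊓ M := by
    refine ⟨?_, M.mul_mem h2 (M.inv_mem (hSM hs))⟩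
    have : n⁻¹ * s * n * s⁻¹ = n⁻¹ * (s * n * s⁻¹) := by group
    rw [this]
    exact N.mul_mem (N.inv_mem hn) (hN.conj_mem n hn s)
  rw [hinf, mem_bot, mul_inv_eq_one, mul_assoc, inv_mul_eq_iff_eq_mul] at h3
  exact h3

end CoreFree

end HallNormalizer

open HallNormalizer in
theorem corollary1p2 {G : Type*} [Group G] [Finite G] (hG : Group.IsSolvable G)
    (H : Subgroup G) (hmax : IsCoatom H) (hnn : ¬ H.Normal)
    (ω : Set ℕ) (hne : ω.Nonempty)
    (hω : ω ⊆ HallNormalizer.primeDivisors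
      (HallNormalizer.fitting (↥H ⧸ H.normalCore.subgroupOf H))) :
    ∃ K : Subgroup G, HallNormalizer.IsHallSubgroup ω K ∧ Subgroup.normalizer (K : Set G) ≤ H := by
  let C := H.normalCore
  let π : G →* G ⧸ C := QuotientGroup.mk' C
  have hπ : Function.Surjective π := QuotientGroup.mk'_surjective C
  have hker : π.ker = C := QuotientGroup.ker_mk' C
  have hCH : C ≤ H := H.normalCore_le
  let M := H.map π
  have hMH : M.comap π = H := comap_map_eq_self (hker.trans_le hCH)
  have hM : IsCoatom M := by
    refine ⟨fun h => hmax.1 (by rw [← hMH, h, comap_top]), fun L hL => ?_⟩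
    have : L.comap π = ⊤ := 
      hmax.2 _ (hMH.symm.trans_lt ((comap_lt_comap_of_surjective hπ).mpr hL))
    exact comap_injective hπ (this.trans (comap_top π).symm)
  have hcore : M.normalCore = ⊥ := by
    refine comap_injective hπ ?_
    rw [MonoidHom.comap_bot, hker]
    refine le_antisymm (normal_le_normalCore.mpr ?_) (hker.ge.trans (MonoidHom.ker_le_comap π _))
    exact (comap_mono M.normalCore_le).trans hMH.le
  have hnt : Nontrivial (G ⧸ C) := by
    exact nontrivial_iff.mp (nontrivial_of_ne M ⊤ hM.1)
  obtain ⟨p, N, hp, hN, hN0, hNc, hNp⟩ := exists_normal_isMulCommutative_isPGroup (G ⧸ C)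
  have hsup := sup_eq_top_of_normalCore_eq_bot hM hcore hN0
  have hinf := inf_eq_bot_of_normalCore_eq_bot hM hcore hN0
  have hidx : H.index = Nat.card N := by
    refine (congrArg index hMH).symm.trans ((index_comap_of_surjective _ hπ).trans
      (IsComplement'.index_eq_card ?_))
    exact isComplement'_of_disjoint_and_mul_eq_univ (disjoint_iff.mpr hinf)
      (by rw [← normal_mul, hsup]; rfl)
  -- Identifies the abstract quotient, whose Fitting subgroup is given, with `M`.
  let ψ : H ⧸ C.subgroupOf H →* G ⧸ C := QuotientGroup.map _ C H.subtype le_rfl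
  have hψ : Function.Injective ψ := by
    rw [← MonoidHom.ker_eq_bot_iff, eq_bot_iff]
    intro x
    induction x using QuotientGroup.induction_on with
    | H h =>
    intro hx
    have : ((h : G) : G ⧸ C) = 1 := hx
    rw [QuotientGroup.eq_one_iff] at this
    exact (QuotientGroup.eq_one_iff h).mpr this
  have hcomp : ψ.comp (QuotientGroup.mk' (C.subgroupOf H)) = π.comp H.subtype := rfl
  have hψr : ψ.range = M := by
    rw [MonoidHom.range_eq_map, ← map_top_of_surjective _ (QuotientGroup.mk'_surjective _),
      map_map, hcomp, ← map_map, ← MonoidHom.range_eq_map, range_subtype]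
  have key : ∀ q ∈ ω, q.Prime ∧ ∃ Q : Subgroup (H ⧸ C.subgroupOf H), Q.Normal ∧ IsPGroup q Q ∧
      N ⊓ centralizer (Q.map ψ : Set (G ⧸ C)) = ⊥ := by
    intro q hq
    obtain ⟨Q, hQ, hQ0, hQq⟩ := exists_normal_isPGroup_of_mem_primeDivisors_fitting (hω hq)
    refine ⟨(hω hq).1, Q, hQ, hQq, inf_centralizer_eq_bot hM hcore hN0 ?_ ?_ ?_⟩
    · rw [← hψr]; exact map_le_range ψ Q
    · rwa [Ne, map_eq_bot_iff_of_injective _ hψ]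
    · have := le_normalizer_map (H := Q) ψ
      rwa [normalizer_eq_top, ← MonoidHom.range_eq_map, hψr] at this
  have hpω : p ∉ ω := by
    intro h
    obtain ⟨-, Q, -, hQ, hb⟩ := key p h
    have : Fact p.Prime := ⟨hp⟩
    exact inf_centralizer_ne_bot_of_isPGroup hN0 hNp (hQ.map ψ) hb
  obtain ⟨S, hS1, hS2⟩ := exists_isHallSubgroup ω H
  refine ⟨S.map H.subtype, ⟨fun q hq hd => ?_, fun q hq hd hqω => ?_⟩, ?_⟩
  · rw [card_map_of_injective H.subtype_injective] at hd
    exact hS1 q hq hd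
  · rw [index_map_subtype, hidx] at hd
    rcases hq.dvd_mul.mp hd with h | h
    · exact hS2 q hq h hqω
    · exact hpω (hNp.eq_of_prime_dvd_card hp hq h ▸ hqω)
  · obtain ⟨q, hq⟩ := hne
    obtain ⟨hqp, Q, hQ, hQq, hb⟩ := key q hq
    have : Fact q.Prime := ⟨hqp⟩
    let T := S.map (QuotientGroup.mk' (C.subgroupOf H))
    have hQT : Q ≤ T := hQq.le_of_normal_of_not_dvd_index fun h =>
      hS2 q hqp (h.trans (index_map_dvd _ (QuotientGroup.mk'_surjective _))) hq
    have hST : (S.map H.subtype).map π = T.map ψ := by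
      rw [map_map, map_map, hcomp]
    refine le_trans (map_le_iff_le_comap.mp ?_) hMH.le
    refine (le_normalizer_map π).trans ?_
    rw [hST]
    refine normalizer_le_of_inf_eq_bot hsup hinf ?_ ?_
    · rw [← hψr]; exact map_le_range ψ T
    · rw [← le_bot_iff, ← hb]
      exact inf_le_inf_left _ (centralizer_le (map_mono hQT))
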